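/- Let $X$ be a finite set with $n$ elements, $X=\{x_1,\dots,x_n\}$, and let $r:X\times X\to X\times X$, $r(x,y)=(\mathcal L_x(y),\mathcal R_y(x))$, be a square-free solution: all maps $\mathcal L_x$ and $\mathcal R_y$ are bijections of $X$ (nondegeneracy), $r^2=\mathrm{id}$ (involutivity), $(r\times\mathrm{id})(\mathrm{id}\times r)(r\times\mathrm{id})=(\mathrm{id}\times r)(r\times\mathrm{id})(\mathrm{id}\times r)$ on $X^3$ (the braid relation), and $r(x,x)=(x,x)$ for all $x\in X$. Let $S=S(X,r)$ and $G=G(X,r)$ be the monoid and the group with generators $X$ and defining relations $xy=\mathcal L_x(y)\mathcal R_y(x)$, $x,y\in X$. Let $\mathcal L:G\to\mathrm{Sym}(X)$ be the homomorphism extending $x\mapsto\mathcal L_x$, let $\mathcal G_L=\mathcal L(G)$, and let the cyclic degree $M$ be the least common multiple of the orders of the permutations $\mathcal L_x$, $x\in X$. Then: 1. The submonoid of $S$ generated by $x_1^M,\dots,x_n^M$ is the free abelian monoid on $x_1^M,\dots,x_n^M$. 2. $S$ is left and right Noetherian, that is, it satisfies the ascending chain condition on left ideals and on right ideals. 3.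 The subgroup $A$ of $G$ generated by $x_1^M,\dots,x_n^M$ is free abelian on $x_1^M,\dots,x_n^M$, is normal in $G$, and has index $M^n$ in $G$. 4. $G$ acts by conjugation on the set $X^{(M)}=\{x_1^M,\dots,x_n^M\}\subseteq G$, and $A$ acts trivially on $X^{(M)}$, so the quotient group $\overline G=G/A$, which is finite of order $M^n$, acts on $X^{(M)}$ by conjugation. 5. $A\subseteq\ker\mathcal L$; hence there is an epimorphism $\overline{\mathcal L}:\overline G\to\mathcal G_L$ with $\mathcal L=\overline{\mathcal L}\circ\nu$, where $\nu:G\to\overline G$ is the natural epimorphism. 6. The order of $\mathcal G_L$ divides $M^n$. -/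

import Mathlib

namespace YangBaxter

universe u

variable {X : Type u}

/-- The left component `L_x(y)` of `r(x,y) = (L_x(y), R_y(x))`. -/
def lact (r : X × X → X × X) (x y : X) : X := (r (x, y)).1

/-- The right component `R_y(x)` of `r(x,y) = (L_x(y), R_y(x))`. -/
def ract (r : X × X → X × X) (y x : X) : X := (r (x, y)).2

/-- `r × id_X` as a self-map of `X × X × X`. -/
def r₁ (r : X × X → X × X) : X × X × X → X × X × X :=
  fun t => ((r (t.1, t.2.1)).1, (r (t.1, t.2.1)).2, t.2.2)

/-- `id_X × r` as a self-map of `X × X × X`. -/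
def r₂ (r : X × X → X × X) : X × X × X → X × X × X :=
  fun t => (t.1, r (t.2.1, t.2.2))

/-- A square-free solution: a nondegenerate, involutive, square-free map `r`
satisfying the braid relation. (An involutive map is automatically bijective.) -/
structure IsSquareFreeSolution (r : X × X → X × X) : Prop where
  left_nondegenerate : ∀ x, Function.Bijective (lact r x)
  right_nondegenerate : ∀ y, Function.Bijective (ract r y)
  involutive : ∀ p, r (r p) = p
  braid : r₁ r ∘ r₂ r ∘ r₁ r = r₂ r ∘ r₁ r ∘ r₂ r
  square_free : ∀ x, r (x, x) = (x, x)

/-- The defining relations `xy = L_x(y) R_y(x)` of the monoid. (Pairs fixed by `r` only contribute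
trivial relations.) -/
def monoidRel (r : X × X → X × X) (u v : FreeMonoid X) : Prop :=
  ∃ x y : X, u = FreeMonoid.of x * FreeMonoid.of y ∧
    v = FreeMonoid.of (lact r x y) * FreeMonoid.of (ract r y x)

/-- The Yang-Baxter monoid `S(X,r)`. -/
abbrev YBMonoid (r : X × X → X × X) : Type u := PresentedMonoid (monoidRel r)

/-- The generator of `S(X,r)` given by `x`. -/
def sgen (r : X × X → X × X) (x : X) : YBMonoid r := PresentedMonoid.of (monoidRel r) x

/-- The defining relators `xy (L_x(y) R_y(x))⁻¹` of the group. -/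
def groupRels (r : X × X → X × X) : Set (FreeGroup X) :=
  {w | ∃ x y : X, w = FreeGroup.of x * FreeGroup.of y *
    (FreeGroup.of (lact r x y) * FreeGroup.of (ract r y x))⁻¹}

/-- The Yang-Baxter group `G(X,r)`. -/
abbrev YBGroup (r : X × X → X × X) : Type u := PresentedGroup (groupRels r)

/-- The generator of `G(X,r)` given by `x`. -/
def ggen (r : X × X → X × X) (x : X) : YBGroup r := PresentedGroup.of x

/-- The permutation `L_x` of `X`. -/
noncomputable def leftPerm {r : X × X → X × X} (h : IsSquareFreeSolution r) (x : X) :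
    Equiv.Perm X :=
  Equiv.ofBijective (lact r x) (h.left_nondegenerate x)

theorem leftPerm_mul {r : X × X → X × X} (h : IsSquareFreeSolution r) (x y : X) :
    leftPerm h x * leftPerm h y = leftPerm h (lact r x y) * leftPerm h (ract r y x) := by
  ext z
  exact (congrArg Prod.fst (congrFun h.braid (x, y, z))).symm

/-- The homomorphism `L : G(X,r) → Sym(X)` extending `x ↦ L_x`. -/
noncomputable def leftHom {r : X × X → X × X} (h : IsSquareFreeSolution r) :
    YBGroup r →* Equiv.Perm X :=
  PresentedGroup.toGroup (f := leftPerm h) (by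
    rintro w ⟨x, y, rfl⟩
    simp only [map_mul, map_inv, FreeGroup.lift_apply_of]
    rw [leftPerm_mul h x y, mul_inv_cancel])

/-- The permutation group `𝒢_L(X,r)`, the image of `L`. -/
noncomputable def leftGroup {r : X × X → X × X} (h : IsSquareFreeSolution r) :
    Subgroup (Equiv.Perm X) :=
  (leftHom h).range

/-- The cyclic degree `M(X,r)`: the least common multiple of the orders of the permutations
`L_x`, `x ∈ X`. -/
noncomputable def cyclicDegree [Fintype X] {r : X × X → X × X} (h : IsSquareFreeSolution r) : ℕ :=
  Finset.univ.lcm fun x => orderOf (leftPerm h x)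

/-- The submonoid `S^k` of `S(X,r)` generated by the `k`-th powers of the generators. -/
def powerMonoid (r : X × X → X × X) (k : ℕ) : Submonoid (YBMonoid r) :=
  Submonoid.closure (Set.range fun x => sgen r x ^ k)

/-- The set `X^(k)` of the `k`-th powers of the generators, in `G(X,r)`. -/
def powerSet (r : X × X → X × X) (k : ℕ) : Set (YBGroup r) :=
  Set.range fun x => ggen r x ^ k

/-- The subgroup of `G(X,r)` generated by the `k`-th powers of the generators. -/
def powerGroup (r : X × X → X × X) (k : ℕ) : Subgroup (YBGroup r) :=
  Subgroup.closure (powerSet r k)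

/-- Ascending chain condition on left ideals (subsets `I` with `S I ⊆ I`). -/
def IsLeftNoetherian (S : Type*) [Monoid S] : Prop := WellFoundedGT (SubMulAction S S)

/-- Ascending chain condition on right ideals (subsets `I` with `I S ⊆ I`). -/
def IsRightNoetherian (S : Type*) [Monoid S] : Prop := WellFoundedGT (SubMulAction Sᵐᵒᵖ S)

end YangBaxter

/-! Let `x` act on `ℤ^X` by `v ↦ L_x v + e_x`. This extends to `G`, and the translation part is a
1-cocycle: `deg (g g') = deg g + L_g (deg g')`. On `S` it is a bijection onto `ℕ^X`: the relations
say exactly that the twisted products raising the degree by `e_x` and by `e_y` commute, so an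
element of `S` is determined by its degree (`deg_toYBGroup_injective`). Square-freeness gives `deg
(x^M) = M e_x`, and `L` kills `x^M`, so `deg` is additive on `A`. Each element of `G` becomes an
element of `S` after multiplication by a product of `M`-th powers, so `deg` is injective on `G`
(`deg_injective`). Hence `A` is the preimage of `M ℤ^X` (`mem_powerGroup_iff`); freeness, normality
and the index are read off from degrees. The Noetherian property is Dickson's lemma for degrees with
the same residues mod `M`. -/

theorem MonoidHom.exists_mulEquiv_of_range_eq {P Q V : Type*} [Monoid P] [Monoid Q] [Monoid V]
    {f : P →* Q} {j : V →* Q} (hf : Function.Injective f) (hj : Function.Injective j)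
    (hr : Set.range f = Set.range j) : ∃ e : V ≃* P, ∀ a, f (e a) = j a := by
  have hex : ∀ a, ∃ p, f p = j a := fun a => hr.symm.subset ⟨a, rfl⟩
  choose e he using hex
  refine ⟨MulEquiv.mk' (Equiv.ofBijective e ⟨fun a b hab => hj ?_, fun p => ?_⟩) fun a b => hf ?_,
    he⟩
  · rw [← he, ← he, hab]
  · obtain ⟨a, ha⟩ := hr.subset ⟨p, rfl⟩
    exact ⟨a, hf ((he a).trans ha)⟩
  · rw [map_mul f]
    exact (he _).trans ((map_mul j a b).trans (congrArg₂ _ (he a) (he b)).symm)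

namespace YangBaxter

universe u

variable {X : Type u} {r : X × X → X × X}

theorem perm_inv_apply_apply (σ : Equiv.Perm X) (x : X) : σ⁻¹ (σ x) = x := σ.symm_apply_apply x

theorem perm_apply_inv_apply (σ : Equiv.Perm X) (x : X) : σ (σ⁻¹ x) = x := σ.apply_symm_apply x

theorem lact_self (h : IsSquareFreeSolution r) (x : X) : lact r x x = x :=
  congrArg Prod.fst (h.square_free x)

theorem lact_lact_ract (h : IsSquareFreeSolution r) (x y : X) :
    lact r (lact r x y) (ract r y x) = x :=
  congrArg Prod.fst (h.involutive (x, y))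

@[simp]
theorem leftPerm_apply (h : IsSquareFreeSolution r) (x y : X) : leftPerm h x y = lact r x y := rfl

theorem leftPerm_self (h : IsSquareFreeSolution r) (x : X) : leftPerm h x x = x := lact_self h x

theorem sgen_mul_sgen (r : X × X → X × X) (x y : X) :
    sgen r x * sgen r y = sgen r (lact r x y) * sgen r (ract r y x) :=
  PresentedMonoid.mk_eq_mk_of_rel ⟨x, y, rfl, rfl⟩

theorem ggen_mul_ggen (r : X × X → X × X) (x y : X) :
    ggen r x * ggen r y = ggen r (lact r x y) * ggen r (ract r y x) :=
  PresentedGroup.mk_eq_mk_of_mul_inv_mem (rels := groupRels r)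
    (x := FreeGroup.of x * FreeGroup.of y)
    (y := FreeGroup.of (lact r x y) * FreeGroup.of (ract r y x)) ⟨x, y, rfl⟩

/-- Involutivity puts the defining relation in a form symmetric in `x` and `y`; this is what makes
`twistMul` left commutative. -/
theorem sgen_mul_sgen_symm (h : IsSquareFreeSolution r) (x y : X) :
    sgen r x * sgen r ((leftPerm h x)⁻¹ y) = sgen r y * sgen r ((leftPerm h y)⁻¹ x) := by
  rw [sgen_mul_sgen]
  have hy : lact r x ((leftPerm h x)⁻¹ y) = y := (leftPerm h x).apply_symm_apply y
  have hx := lact_lact_ract h x ((leftPerm h x)⁻¹ y)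
  rw [hy] at hx ⊢
  congr 2
  exact (leftPerm h y).eq_symm_apply.2 hx

/-- The canonical homomorphism from `S(X,r)` to `G(X,r)`. -/
def toYBGroup (r : X × X → X × X) : YBMonoid r →* YBGroup r :=
  PresentedMonoid.lift (ggen r) (by
    rintro _ _ ⟨x, y, rfl, rfl⟩
    simpa using ggen_mul_ggen r x y)

@[simp]
theorem toYBGroup_sgen (r : X × X → X × X) (x : X) : toYBGroup r (sgen r x) = ggen r x := rfl

theorem YBMonoid.induction_right {p : YBMonoid r → Prop} (s : YBMonoid r) (one : p 1)
    (mul : ∀ s x, p s → p (s * sgen r x)) : p s := by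
  have hs : s ∈ Submonoid.closure (Set.range (PresentedMonoid.of (monoidRel r))) := by
    rw [PresentedMonoid.closure_range_of]; trivial
  induction hs using Submonoid.closure_induction_right with
  | one => exact one
  | mul_right s _ y hy ih => obtain ⟨x, rfl⟩ := hy; exact mul s x ih

theorem YBGroup.induction_right {p : YBGroup r → Prop} (g : YBGroup r) (one : p 1)
    (mul : ∀ g x, p g → p (g * ggen r x)) (mul_inv : ∀ g x, p g → p (g * (ggen r x)⁻¹)) :
    p g := by
  have hg : g ∈ Subgroup.closure (Set.range (PresentedGroup.of (rels := groupRels r))) := by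
    rw [PresentedGroup.closure_range_of]; trivial
  induction hg using Subgroup.closure_induction_right with
  | one => exact one
  | mul_right g _ y hy ih => obtain ⟨x, rfl⟩ := hy; exact mul g x ih
  | mul_inv_cancel g _ y hy ih => obtain ⟨x, rfl⟩ := hy; exact mul_inv g x ih

@[simp]
theorem leftHom_ggen (h : IsSquareFreeSolution r) (x : X) : leftHom h (ggen r x) = leftPerm h x :=
  PresentedGroup.toGroup.of _

/-! ### The affine action and the degree cocycle -/

section Degree

variable [DecidableEq X]

/-- The affine permutation `v ↦ L_x v + e_x` of `ℤ^X`. -/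
noncomputable def affinePerm (h : IsSquareFreeSolution r) (x : X) : Equiv.Perm (X → ℤ) :=
  (Equiv.arrowCongr (leftPerm h x) (Equiv.refl ℤ)).trans (Equiv.addRight (Pi.single x 1))

theorem affinePerm_apply (h : IsSquareFreeSolution r) (x : X) (v : X → ℤ) (z : X) :
    affinePerm h x v z = v ((leftPerm h x)⁻¹ z) + (Pi.single x 1 : X → ℤ) z := rfl

theorem single_inv_apply (σ : Equiv.Perm X) (y : X) (k : ℤ) (z : X) :
    (Pi.single y k : X → ℤ) (σ⁻¹ z) = (Pi.single (σ y) k : X → ℤ) z := by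
  simp only [Pi.single_apply, Equiv.Perm.inv_eq_iff_eq]

/-- The linear parts agree by the braid relation. Both translation parts are `e_x + e_{L_x(y)}`,
because `L_{L_x(y)}` sends `R_y(x)` to `x`. -/
theorem affinePerm_mul (h : IsSquareFreeSolution r) (x y : X) :
    affinePerm h x * affinePerm h y =
      affinePerm h (lact r x y) * affinePerm h (ract r y x) := by
  ext v z
  simp only [Equiv.Perm.mul_apply, affinePerm_apply, single_inv_apply, leftPerm_apply,
    lact_lact_ract h]
  rw [← Equiv.Perm.mul_apply, ← Equiv.Perm.mul_apply, ← mul_inv_rev, ← mul_inv_rev,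
    leftPerm_mul h x y]
  ring

/-- The affine action of `G(X,r)` on `ℤ^X`, in which `x` acts by `v ↦ L_x v + e_x`. -/
noncomputable def affineHom (h : IsSquareFreeSolution r) : YBGroup r →* Equiv.Perm (X → ℤ) :=
  PresentedGroup.toGroup (f := affinePerm h) (by
    rintro w ⟨x, y, rfl⟩
    simp only [map_mul, map_inv, FreeGroup.lift_apply_of]
    rw [affinePerm_mul h x y, mul_inv_cancel])

@[simp]
theorem affineHom_ggen (h : IsSquareFreeSolution r) (x : X) :
    affineHom h (ggen r x) = affinePerm h x :=
  PresentedGroup.toGroup.of _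

/-- The bijective 1-cocycle `G(X,r) → ℤ^X` that sends `x` to `e_x`. -/
noncomputable def deg (h : IsSquareFreeSolution r) (g : YBGroup r) : X → ℤ := affineHom h g 0

theorem affineHom_apply (h : IsSquareFreeSolution r) (g : YBGroup r) (v : X → ℤ) (z : X) :
    affineHom h g v z = deg h g z + v ((leftHom h g)⁻¹ z) := by
  induction g using YBGroup.induction_right generalizing v z with
  | one => simp [deg]
  | mul g x ih =>
    rw [deg, map_mul, Equiv.Perm.mul_apply, Equiv.Perm.mul_apply, ih, ih]
    simp only [affineHom_ggen, affinePerm_apply, map_mul, Equiv.Perm.mul_apply,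
      leftHom_ggen, mul_inv_rev, Pi.zero_apply]
    ring
  | mul_inv g x ih =>
    -- The inverse of `v ↦ L_x v + e_x` is `w ↦ L_x⁻¹ (w - e_x)`.
    have key : ∀ w z, ((affinePerm h x)⁻¹ : Equiv.Perm (X → ℤ)) w z =
        w (leftPerm h x z) - (Pi.single x 1 : X → ℤ) (leftPerm h x z) := by
      intro w z
      have := affinePerm_apply h x ((affinePerm h x)⁻¹ w) (leftPerm h x z)
      rw [perm_apply_inv_apply, perm_inv_apply_apply] at this
      linarith
    rw [deg, map_mul, Equiv.Perm.mul_apply, Equiv.Perm.mul_apply, ih, ih]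
    simp only [map_inv, map_mul, Equiv.Perm.mul_apply, affineHom_ggen, key,
      leftHom_ggen, mul_inv_rev, Pi.zero_apply, inv_inv]
    ring

@[simp]
theorem deg_one (h : IsSquareFreeSolution r) : deg h 1 = 0 := by simp [deg]

theorem deg_mul (h : IsSquareFreeSolution r) (g g' : YBGroup r) (z : X) :
    deg h (g * g') z = deg h g z + deg h g' ((leftHom h g)⁻¹ z) := by
  rw [← affineHom_apply]; simp [deg]

theorem deg_ggen (h : IsSquareFreeSolution r) (x : X) : deg h (ggen r x) = Pi.single x 1 := by
  ext z
  rw [deg, affineHom_ggen, affinePerm_apply]; simp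

theorem deg_inv (h : IsSquareFreeSolution r) (g : YBGroup r) (z : X) :
    deg h g⁻¹ z = - deg h g (leftHom h g z) := by
  have := deg_mul h g g⁻¹ (leftHom h g z)
  rw [mul_inv_cancel, deg_one, perm_inv_apply_apply, Pi.zero_apply] at this
  linarith

/-- Square-freeness enters here: `L_x` fixes `e_x`, so each further factor `x` adds `e_x`. -/
theorem deg_ggen_pow (h : IsSquareFreeSolution r) (x : X) (k : ℕ) :
    deg h (ggen r x ^ k) = Pi.single x (k : ℤ) := by
  induction k with
  | zero => simp
  | succ k ih =>
    ext z
    rw [pow_succ', deg_mul, ih, deg_ggen, leftHom_ggen, single_inv_apply, leftPerm_self]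
    simp only [Pi.single_apply]
    split_ifs <;> simp [add_comm]

theorem deg_mul_of_left_trivial (h : IsSquareFreeSolution r) {g : YBGroup r}
    (hg : leftHom h g = 1) (g' : YBGroup r) : deg h (g * g') = deg h g + deg h g' := by
  ext z; simp [deg_mul, hg]

end Degree

/-! ### Elements of the monoid are determined by their degrees -/

section Normal

/-- Right multiplication by `x`, twisted so that it raises the degree by `e_x`. -/
noncomputable def twistMul (h : IsSquareFreeSolution r) (x : X) (s : YBMonoid r) : YBMonoid r :=
  s * sgen r ((leftHom h (toYBGroup r s))⁻¹ x)

instance (h : IsSquareFreeSolution r) : LeftCommutative (twistMul h) where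
  left_comm x y s := by
    simp only [twistMul, map_mul, toYBGroup_sgen, leftHom_ggen, mul_inv_rev,
      Equiv.Perm.mul_apply, mul_assoc, sgen_mul_sgen_symm h]

/-- The element of `S(X,r)` of a given degree. -/
noncomputable def ofDeg (h : IsSquareFreeSolution r) (m : Multiset X) : YBMonoid r :=
  m.foldr (twistMul h) 1

theorem exists_ofDeg_eq (h : IsSquareFreeSolution r) (s : YBMonoid r) : ∃ m, ofDeg h m = s := by
  induction s using YBMonoid.induction_right with
  | one => exact ⟨0, rfl⟩
  | mul s x ih =>
    obtain ⟨m, rfl⟩ := ih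
    -- Applying `L_s` to the letter undoes the twist, so that `twistMul` appends `x` itself.
    refine ⟨leftHom h (toYBGroup r (ofDeg h m)) x ::ₘ m, ?_⟩
    rw [ofDeg, Multiset.foldr_cons, ← ofDeg, twistMul, perm_inv_apply_apply]

variable [DecidableEq X]

theorem deg_ofDeg (h : IsSquareFreeSolution r) (m : Multiset X) (z : X) :
    deg h (toYBGroup r (ofDeg h m)) z = m.count z := by
  induction m using Multiset.induction_on with
  | empty => simp [ofDeg]
  | cons x m ih =>
    rw [ofDeg] at ih ⊢
    rw [Multiset.foldr_cons, twistMul, map_mul, deg_mul, ih, toYBGroup_sgen, deg_ggen,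
      single_inv_apply, Multiset.count_cons, Pi.single_apply]
    simp

theorem deg_toYBGroup_injective (h : IsSquareFreeSolution r) :
    Function.Injective fun s => deg h (toYBGroup r s) := by
  intro s t hst
  obtain ⟨m, rfl⟩ := exists_ofDeg_eq h s
  obtain ⟨m', rfl⟩ := exists_ofDeg_eq h t
  congr 1
  ext z
  simpa [deg_ofDeg] using congrFun hst z

theorem deg_toYBGroup_nonneg (h : IsSquareFreeSolution r) (s : YBMonoid r) (z : X) :
    0 ≤ deg h (toYBGroup r s) z := by
  obtain ⟨m, rfl⟩ := exists_ofDeg_eq h s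
  simp [deg_ofDeg]

theorem exists_deg_toYBGroup_eq [Fintype X] (h : IsSquareFreeSolution r) (v : X → ℕ) :
    ∃ s, ∀ z, deg h (toYBGroup r s) z = v z := by
  refine ⟨ofDeg h (Finsupp.toMultiset (Finsupp.equivFunOnFinite.symm v)), fun z => ?_⟩
  simp [deg_ofDeg]

end Normal

/-! ### Powers of the generators and injectivity of the degree on the group -/

section CyclicDegree

theorem toYBGroup_mem_powerGroup {k : ℕ} {s : YBMonoid r} (hs : s ∈ powerMonoid r k) :
    toYBGroup r s ∈ powerGroup r k := by
  have : powerMonoid r k ≤ (powerGroup r k).toSubmonoid.comap (toYBGroup r) := by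
    rw [powerMonoid, Submonoid.closure_le]
    rintro _ ⟨x, rfl⟩
    exact Subgroup.subset_closure ⟨x, by simp⟩
  exact this hs

variable [Fintype X]

theorem cyclicDegree_pos (h : IsSquareFreeSolution r) : 0 < cyclicDegree h := by
  classical
  refine Nat.pos_of_ne_zero fun h0 => ?_
  rw [cyclicDegree, Finset.lcm_eq_zero_iff] at h0
  obtain ⟨x, -, hx⟩ := h0
  exact (orderOf_pos (leftPerm h x)).ne' hx

theorem leftHom_ggen_pow (h : IsSquareFreeSolution r) (x : X) :
    leftHom h (ggen r x ^ cyclicDegree h) = 1 := by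
  rw [map_pow, leftHom_ggen]
  exact orderOf_dvd_iff_pow_eq_one.1 (Finset.dvd_lcm (Finset.mem_univ x))

theorem powerGroup_le_ker (h : IsSquareFreeSolution r) :
    powerGroup r (cyclicDegree h) ≤ (leftHom h).ker := by
  rw [powerGroup, Subgroup.closure_le]
  rintro _ ⟨x, rfl⟩
  exact leftHom_ggen_pow h x

variable [DecidableEq X]

theorem mul_sgen_pow (h : IsSquareFreeSolution r) (s : YBMonoid r) (x : X) :
    s * sgen r x ^ cyclicDegree h =
      sgen r (leftHom h (toYBGroup r s) x) ^ cyclicDegree h * s := by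
  apply deg_toYBGroup_injective h
  ext z
  simp only [map_mul, map_pow, toYBGroup_sgen]
  rw [deg_mul, deg_mul, leftHom_ggen_pow, deg_ggen_pow, deg_ggen_pow, single_inv_apply]
  simp [add_comm]

/-- Products of `M`-th powers suffice as left denominators for `G`. -/
theorem exists_mul_eq_toYBGroup (h : IsSquareFreeSolution r) (g : YBGroup r) :
    ∃ a ∈ powerMonoid r (cyclicDegree h), ∃ s, toYBGroup r a * g = toYBGroup r s := by
  induction g using YBGroup.induction_right with
  | one => exact ⟨1, one_mem _, 1, by simp⟩
  | mul g x ih =>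
    obtain ⟨a, ha, s, hs⟩ := ih
    exact ⟨a, ha, s * sgen r x, by rw [← mul_assoc, hs, map_mul, toYBGroup_sgen]⟩
  | mul_inv g x ih =>
    obtain ⟨a, ha, s, hs⟩ := ih
    -- Passing through `s`, the new power becomes `x^M` on the right, and one of its factors cancels
    -- `x⁻¹`.
    refine ⟨sgen r (leftHom h (toYBGroup r s) x) ^ cyclicDegree h * a,
      mul_mem (Submonoid.subset_closure ⟨_, rfl⟩) ha, s * sgen r x ^ (cyclicDegree h - 1), ?_⟩
    rw [map_mul, ← mul_assoc, mul_assoc _ _ g, hs, ← map_mul, ← mul_sgen_pow, mul_inv_eq_iff_eq_mul,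
      ← toYBGroup_sgen r x, ← map_mul, mul_assoc, ← pow_succ,
      Nat.sub_add_cancel (cyclicDegree_pos h)]

/-- Clear denominators, `a g = s` and `b g' = t`. Since `L` kills `a` and `b`, equal degrees of `g`
and `g'` give `b s` and `a t` equal degrees, so they agree in `S`; then cancel `ab = ba`. -/
theorem deg_injective (h : IsSquareFreeSolution r) : Function.Injective (deg h) := by
  intro g g' hg
  obtain ⟨a, ha, s, hs⟩ := exists_mul_eq_toYBGroup h g
  obtain ⟨b, hb, t, ht⟩ := exists_mul_eq_toYBGroup h g'
  have ka := powerGroup_le_ker h (toYBGroup_mem_powerGroup ha)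
  have kb := powerGroup_le_ker h (toYBGroup_mem_powerGroup hb)
  rw [MonoidHom.mem_ker] at ka kb
  have hab : a * b = b * a := by
    apply deg_toYBGroup_injective h
    simp only [map_mul]
    rw [deg_mul_of_left_trivial h ka, deg_mul_of_left_trivial h kb, add_comm]
  have hst : b * s = a * t := by
    apply deg_toYBGroup_injective h
    simp only [map_mul]
    rw [← hs, ← ht, deg_mul_of_left_trivial h ka, deg_mul_of_left_trivial h kb,
      deg_mul_of_left_trivial h ka, deg_mul_of_left_trivial h kb, hg, add_left_comm]
  have := congrArg (toYBGroup r) hst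
  rw [map_mul, map_mul, ← hs, ← ht, ← mul_assoc, ← mul_assoc, ← map_mul, ← map_mul, hab] at this
  exact mul_left_cancel this

theorem conj_ggen_pow (h : IsSquareFreeSolution r) (g : YBGroup r) (x : X) :
    g * ggen r x ^ cyclicDegree h * g⁻¹ = ggen r (leftHom h g x) ^ cyclicDegree h := by
  rw [mul_inv_eq_iff_eq_mul]
  apply deg_injective h
  ext z
  rw [deg_mul, deg_mul, leftHom_ggen_pow, deg_ggen_pow, deg_ggen_pow, single_inv_apply]
  simp [add_comm]

theorem exists_mem_powerMonoid_deg_eq (h : IsSquareFreeSolution r) (v : X → ℕ) :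
    ∃ s ∈ powerMonoid r (cyclicDegree h),
      deg h (toYBGroup r s) = fun z => (cyclicDegree h : ℤ) * v z := by
  have key : ∀ F : Finset X, ∃ s ∈ powerMonoid r (cyclicDegree h),
      deg h (toYBGroup r s) = fun z => if z ∈ F then (cyclicDegree h : ℤ) * v z else 0 := by
    intro F
    induction F using Finset.induction_on with
    | empty => exact ⟨1, one_mem _, by ext; simp⟩
    | insert x F hx ih =>
      obtain ⟨s, hs, hd⟩ := ih
      have hm : (sgen r x ^ cyclicDegree h) ^ v x ∈ powerMonoid r (cyclicDegree h) :=
        pow_mem (Submonoid.subset_closure (Set.mem_range_self x)) _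
      refine ⟨(sgen r x ^ cyclicDegree h) ^ v x * s, mul_mem hm hs, ?_⟩
      rw [map_mul, deg_mul_of_left_trivial h (powerGroup_le_ker h (toYBGroup_mem_powerGroup hm)),
        hd, ← pow_mul, map_pow, toYBGroup_sgen, deg_ggen_pow]
      ext z
      by_cases hz : z = x
      · subst hz; simp [hx]
      · simp [hz]
  obtain ⟨s, hs, hd⟩ := key Finset.univ
  exact ⟨s, hs, by simpa using hd⟩

theorem exists_mem_powerGroup_deg_eq (h : IsSquareFreeSolution r) (v : X → ℤ) :
    ∃ g ∈ powerGroup r (cyclicDegree h), deg h g = fun z => (cyclicDegree h : ℤ) * v z := by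
  -- Split `v` into its positive and negative parts.
  obtain ⟨s, hs, hsd⟩ := exists_mem_powerMonoid_deg_eq h fun z => (v z).toNat
  obtain ⟨t, ht, htd⟩ := exists_mem_powerMonoid_deg_eq h fun z => (-v z).toNat
  have hs' := toYBGroup_mem_powerGroup hs
  have ht' := toYBGroup_mem_powerGroup ht
  refine ⟨toYBGroup r s * (toYBGroup r t)⁻¹, mul_mem hs' (inv_mem ht'), ?_⟩
  have hk : leftHom h (toYBGroup r t) = 1 := powerGroup_le_ker h ht'
  rw [deg_mul_of_left_trivial h (powerGroup_le_ker h hs')]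
  ext z
  rw [Pi.add_apply, deg_inv, hk, Equiv.Perm.one_apply, hsd, htd, ← sub_eq_add_neg, ← mul_sub]
  congr 1
  omega

theorem mem_powerGroup_iff (h : IsSquareFreeSolution r) (g : YBGroup r) :
    g ∈ powerGroup r (cyclicDegree h) ↔ ∀ z, (cyclicDegree h : ℤ) ∣ deg h g z := by
  constructor
  · intro hg
    induction hg using Subgroup.closure_induction with
    | mem g hg =>
      obtain ⟨x, rfl⟩ := hg
      intro z
      rw [deg_ggen_pow, Pi.single_apply]
      split_ifs <;> simp
    | one => simp
    | mul g g' _ _ ih ih' => exact fun z => deg_mul h g g' z ▸ dvd_add (ih _) (ih' _)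
    | inv g _ ih => exact fun z => deg_inv h g z ▸ (ih _).neg_right
  · intro hg
    choose v hv using hg
    obtain ⟨a, ha, hd⟩ := exists_mem_powerGroup_deg_eq h v
    exact deg_injective h (hd.trans (funext fun z => (hv z).symm)) ▸ ha

/-! ### Freeness, normality and index -/

theorem powerMonoid_free (h : IsSquareFreeSolution r) :
    ∃ e : Multiplicative (X →₀ ℕ) ≃* powerMonoid r (cyclicDegree h),
      ∀ x, (e (Multiplicative.ofAdd (Finsupp.single x 1)) : YBMonoid r) =
        sgen r x ^ cyclicDegree h := by
  have hM : (cyclicDegree h : ℤ) ≠ 0 := by exact_mod_cast (cyclicDegree_pos h).ne'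
  let f : powerMonoid r (cyclicDegree h) →* Multiplicative (X → ℤ) :=
    { toFun s := .ofAdd (deg h (toYBGroup r s))
      map_one' := by simp
      map_mul' s t := by
        rw [Submonoid.coe_mul, map_mul, deg_mul_of_left_trivial h
          (powerGroup_le_ker h (toYBGroup_mem_powerGroup s.2)), ofAdd_add] }
  -- The degree and `j` are injective with the same range, the nonnegative multiples of `M`;
  -- comparing them gives the isomorphism.
  let j : (X →₀ ℕ) →+ (X → ℤ) :=
    { toFun a := fun z => (cyclicDegree h : ℤ) * a z
      map_zero' := by ext; simp
      map_add' a b := by ext; simp [mul_add] }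
  obtain ⟨e, he⟩ := MonoidHom.exists_mulEquiv_of_range_eq (f := f)
    (j := AddMonoidHom.toMultiplicative j)
    (fun s t hst => Subtype.ext (deg_toYBGroup_injective h hst))
    (fun a b hab => Finsupp.ext fun z => by
      exact Int.ofNat_inj.1 (mul_left_cancel₀ hM (congrFun (congrArg Multiplicative.toAdd hab) z)))
    (by
      apply Set.Subset.antisymm
      · rintro _ ⟨s, rfl⟩
        have hs := (mem_powerGroup_iff h _).1 (toYBGroup_mem_powerGroup s.2)
        choose v hv using hs
        have hv0 : ∀ z, 0 ≤ v z := fun z => by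
          have := hv z ▸ deg_toYBGroup_nonneg h s.1 z
          exact nonneg_of_mul_nonneg_right this (by exact_mod_cast cyclicDegree_pos h)
        refine ⟨.ofAdd (Finsupp.equivFunOnFinite.symm fun z => (v z).toNat), ?_⟩
        refine congrArg Multiplicative.ofAdd (funext fun z => ?_)
        rw [hv z]
        simp [hv0 z, j]
      · rintro _ ⟨a, rfl⟩
        obtain ⟨s, hs, hd⟩ := exists_mem_powerMonoid_deg_eq h a.toAdd
        exact ⟨⟨s, hs⟩, congrArg Multiplicative.ofAdd hd⟩)
  refine ⟨e, fun x => deg_toYBGroup_injective h ?_⟩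
  refine (congrArg Multiplicative.toAdd (he _)).trans ?_
  ext z
  simp [j, deg_ggen_pow, Finsupp.single_apply, Pi.single_apply, eq_comm]

theorem powerGroup_free (h : IsSquareFreeSolution r) :
    ∃ e : Multiplicative (X →₀ ℤ) ≃* powerGroup r (cyclicDegree h),
      ∀ x, (e (Multiplicative.ofAdd (Finsupp.single x 1)) : YBGroup r) =
        ggen r x ^ cyclicDegree h := by
  have hM : (cyclicDegree h : ℤ) ≠ 0 := by exact_mod_cast (cyclicDegree_pos h).ne'
  let f : powerGroup r (cyclicDegree h) →* Multiplicative (X → ℤ) :=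
    { toFun g := .ofAdd (deg h g)
      map_one' := by simp
      map_mul' g g' := by
        rw [Subgroup.coe_mul, deg_mul_of_left_trivial h (powerGroup_le_ker h g.2), ofAdd_add] }
  let j : (X →₀ ℤ) →+ (X → ℤ) :=
    { toFun a := fun z => (cyclicDegree h : ℤ) * a z
      map_zero' := by ext; simp
      map_add' a b := by ext; simp [mul_add] }
  obtain ⟨e, he⟩ := MonoidHom.exists_mulEquiv_of_range_eq (f := f)
    (j := AddMonoidHom.toMultiplicative j)
    (fun s t hst => Subtype.ext (deg_injective h hst))
    (fun a b hab => Finsupp.ext fun z => by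
      exact mul_left_cancel₀ hM (congrFun (congrArg Multiplicative.toAdd hab) z))
    (by
      apply Set.Subset.antisymm
      · rintro _ ⟨g, rfl⟩
        have hg := (mem_powerGroup_iff h _).1 g.2
        choose v hv using hg
        refine ⟨.ofAdd (Finsupp.equivFunOnFinite.symm v), ?_⟩
        exact congrArg Multiplicative.ofAdd (funext fun z => (hv z).symm)
      · rintro _ ⟨a, rfl⟩
        obtain ⟨g, hg, hd⟩ := exists_mem_powerGroup_deg_eq h a.toAdd
        exact ⟨⟨g, hg⟩, congrArg Multiplicative.ofAdd hd⟩)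
  refine ⟨e, fun x => deg_injective h ?_⟩
  refine (congrArg Multiplicative.toAdd (he _)).trans ?_
  ext z
  simp [j, deg_ggen_pow, Finsupp.single_apply, Pi.single_apply, eq_comm]

theorem powerGroup_normal (h : IsSquareFreeSolution r) :
    (powerGroup r (cyclicDegree h)).Normal where
  conj_mem a ha g := by
    have hk : leftHom h a = 1 := powerGroup_le_ker h ha
    rw [mem_powerGroup_iff] at ha ⊢
    intro z
    rw [deg_mul, deg_mul, deg_inv, map_mul, hk, mul_one, perm_apply_inv_apply]
    simpa using ha _

theorem powerGroup_quotient_equiv (h : IsSquareFreeSolution r) :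
    Nonempty ((YBGroup r ⧸ powerGroup r (cyclicDegree h)) ≃ (X → ZMod (cyclicDegree h))) := by
  have key : ∀ g g' : YBGroup r, g⁻¹ * g' ∈ powerGroup r (cyclicDegree h) ↔
      (fun z => (deg h g z : ZMod (cyclicDegree h))) = fun z => (deg h g' z : ZMod _) := by
    intro g g'
    rw [mem_powerGroup_iff, funext_iff]
    -- The degree of `g⁻¹ g'` is `deg g' - deg g` with coordinates permuted by `L_g`, which does not
    -- affect divisibility at all coordinates.
    refine Iff.trans (forall_congr' fun z => ?_) (leftHom h g).surjective.forall.symm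
    rw [ZMod.intCast_eq_intCast_iff_dvd_sub, deg_mul, deg_inv, map_inv, inv_inv,
      ← sub_eq_neg_add]
  refine ⟨Equiv.ofBijective (Quotient.lift (s := QuotientGroup.leftRel _)
    (fun g z => (deg h g z : ZMod (cyclicDegree h)))
    fun g g' hg => (key g g').1 (QuotientGroup.leftRel_apply.1 hg)) ⟨?_, fun v => ?_⟩⟩
  · rintro ⟨g⟩ ⟨g'⟩ hg
    exact QuotientGroup.eq.2 ((key g g').2 hg)
  · have : NeZero (cyclicDegree h) := ⟨(cyclicDegree_pos h).ne'⟩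
    obtain ⟨s, hs⟩ := exists_deg_toYBGroup_eq h fun z => (v z).val
    refine ⟨QuotientGroup.mk (toYBGroup r s), funext fun z => ?_⟩
    change ((deg h (toYBGroup r s) z : ℤ) : ZMod (cyclicDegree h)) = v z
    simp [hs]

/-! ### Noetherian property -/

/-- Dickson's lemma for `S(X,r)`, modulo the cyclic degree. -/
theorem exists_lt_deg_eq_add (h : IsSquareFreeSolution r) (f : ℕ → YBMonoid r) :
    ∃ i j, i < j ∧ ∃ v : X → ℕ, ∀ z,
      deg h (toYBGroup r (f j)) z = deg h (toYBGroup r (f i)) z + (cyclicDegree h : ℤ) * v z := by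
  have : NeZero (cyclicDegree h) := ⟨(cyclicDegree_pos h).ne'⟩
  -- Product of the componentwise order on `ℕ^X` with equality on the finite set of residues.
  have wqo := (wellQuasiOrdered_le (α := X → ℕ)).prod
    (Finite.wellQuasiOrdered (Eq : (X → ZMod (cyclicDegree h)) → _ → Prop))
  obtain ⟨i, j, hij, hle, heq⟩ := wqo fun n => (fun z => (deg h (toYBGroup r (f n)) z).toNat,
    fun z => (deg h (toYBGroup r (f n)) z : ZMod (cyclicDegree h)))
  have hdvd : ∀ z, (cyclicDegree h : ℤ) ∣
      deg h (toYBGroup r (f j)) z - deg h (toYBGroup r (f i)) z := fun z =>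
    (ZMod.intCast_eq_intCast_iff_dvd_sub _ _ _).1 (congrFun heq z)
  choose v hv using hdvd
  refine ⟨i, j, hij, fun z => (v z).toNat, fun z => ?_⟩
  have h1 : (deg h (toYBGroup r (f i)) z).toNat ≤ (deg h (toYBGroup r (f j)) z).toNat := hle z
  have h2 := deg_toYBGroup_nonneg h (f j) z
  have h3 : 0 ≤ (cyclicDegree h : ℤ) * v z := by rw [← hv]; omega
  have h4 : 0 ≤ v z := nonneg_of_mul_nonneg_right h3 (by exact_mod_cast cyclicDegree_pos h)
  rw [Int.toNat_of_nonneg h4, ← hv]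
  ring

theorem exists_lt_eq_mul (h : IsSquareFreeSolution r) (f : ℕ → YBMonoid r) :
    ∃ i j, i < j ∧ ∃ t, f j = t * f i := by
  obtain ⟨i, j, hij, v, hv⟩ := exists_lt_deg_eq_add h f
  obtain ⟨t, ht, hd⟩ := exists_mem_powerMonoid_deg_eq h v
  refine ⟨i, j, hij, t, deg_toYBGroup_injective h (funext fun z => ?_)⟩
  dsimp only
  rw [map_mul, deg_mul_of_left_trivial h (powerGroup_le_ker h (toYBGroup_mem_powerGroup ht)), hd,
    hv, add_comm, Pi.add_apply]

theorem exists_lt_eq_mul_right (h : IsSquareFreeSolution r) (f : ℕ → YBMonoid r) :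
    ∃ i j, i < j ∧ ∃ t, f j = f i * t := by
  obtain ⟨i, j, hij, v, hv⟩ := exists_lt_deg_eq_add h f
  -- A right factor contributes its degree twisted by `L_{f i}`, so the desired difference is
  -- untwisted beforehand.
  obtain ⟨t, ht⟩ := exists_deg_toYBGroup_eq h fun z =>
    cyclicDegree h * v (leftHom h (toYBGroup r (f i)) z)
  refine ⟨i, j, hij, t, deg_toYBGroup_injective h (funext fun z => ?_)⟩
  dsimp only
  rw [map_mul, deg_mul, ht, hv, perm_apply_inv_apply, Nat.cast_mul]

end CyclicDegree

/-- In a strictly ascending chain choose `f n` in `I (n + 1)` but not in `I n`. If `f j` is a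
multiple of `f i` with `i < j`, it lies in `I j`, a contradiction. -/
theorem wellFoundedGT_subMulAction {S α : Type*} [Monoid S] [MulAction S α]
    (hα : ∀ f : ℕ → α, ∃ i j, i < j ∧ ∃ t : S, f j = t • f i) :
    WellFoundedGT (SubMulAction S α) := by
  rw [WellFoundedGT, isWellFounded_iff, RelEmbedding.wellFounded_iff_isEmpty]
  refine ⟨fun I => ?_⟩
  have hlt : ∀ {m n}, m < n → I m < I n := fun hmn => I.map_rel_iff.2 hmn
  have hex : ∀ n, ∃ a ∈ I (n + 1), a ∉ I n := fun n => Set.exists_of_ssubset (hlt n.lt_succ_self)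
  choose f hf hf' using hex
  obtain ⟨i, j, hij, t, ht⟩ := hα f
  have hle : I (i + 1) ≤ I j := (Nat.succ_le_of_lt hij).eq_or_lt.elim
    (fun e => (congrArg I e).le) fun l => (hlt l).le
  exact hf' j (ht ▸ (I j).smul_mem t (hle (hf i)))

/-! ### Conjugation on the powers and the main theorem -/

theorem conj_mem_powerSet [Fintype X] [DecidableEq X] (h : IsSquareFreeSolution r) (g : YBGroup r)
    {u : YBGroup r} (hu : u ∈ powerSet r (cyclicDegree h)) :
    g * u * g⁻¹ ∈ powerSet r (cyclicDegree h) := by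
  obtain ⟨x, rfl⟩ := hu
  exact ⟨_, (conj_ggen_pow h g x).symm⟩

/-- The conjugation action of `G(X,r)` on the powers `x^M` of the generators. -/
noncomputable def powerSetConj [Fintype X] [DecidableEq X] (h : IsSquareFreeSolution r) :
    YBGroup r →* Equiv.Perm (powerSet r (cyclicDegree h)) :=
  MonoidHom.toHomPerm
    { toFun g u := ⟨g * u * g⁻¹, conj_mem_powerSet h g u.2⟩
      map_one' := by funext u; simp; rfl
      map_mul' g g' := by
        funext u
        refine Subtype.ext ?_
        change g * g' * u * (g * g')⁻¹ = g * (g' * u * g'⁻¹) * g⁻¹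
        group }

theorem powerSetConj_apply [Fintype X] [DecidableEq X] (h : IsSquareFreeSolution r)
    (g : YBGroup r) (u : powerSet r (cyclicDegree h)) :
    (powerSetConj h g u : YBGroup r) = g * u * g⁻¹ := rfl

theorem powerSetConj_eq_one [Fintype X] [DecidableEq X] (h : IsSquareFreeSolution r)
    {a : YBGroup r} (ha : a ∈ powerGroup r (cyclicDegree h)) : powerSetConj h a = 1 := by
  ext ⟨_, x, rfl⟩
  have hk : leftHom h a = 1 := powerGroup_le_ker h ha
  rw [powerSetConj_apply, conj_ggen_pow, hk]
  rfl

end YangBaxter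

theorem mainTheorem7 {X : Type*} [Fintype X] (r : X × X → X × X)
    (h : YangBaxter.IsSquareFreeSolution r) (M : ℕ) (hM : M = YangBaxter.cyclicDegree h) :
    -- the submonoid generated by the `x^M` is free abelian on these elements
    (∃ e : Multiplicative (X →₀ ℕ) ≃* YangBaxter.powerMonoid r M,
      ∀ x, (e (Multiplicative.ofAdd (Finsupp.single x 1)) : YangBaxter.YBMonoid r) =
        YangBaxter.sgen r x ^ M) ∧
    -- the monoid is left and right Noetherian
    YangBaxter.IsLeftNoetherian (YangBaxter.YBMonoid r) ∧
    YangBaxter.IsRightNoetherian (YangBaxter.YBMonoid r) ∧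
    -- the subgroup `A` generated by the `x^M` is free abelian on these elements
    (∃ e : Multiplicative (X →₀ ℤ) ≃* YangBaxter.powerGroup r M,
      ∀ x, (e (Multiplicative.ofAdd (Finsupp.single x 1)) : YangBaxter.YBGroup r) =
        YangBaxter.ggen r x ^ M) ∧
    -- `A` is normal, and `G/A` is finite of order `M^n`
    ∃ _ : (YangBaxter.powerGroup r M).Normal,
      Finite (YangBaxter.YBGroup r ⧸ YangBaxter.powerGroup r M) ∧
      (YangBaxter.powerGroup r M).index = M ^ Fintype.card X ∧
      -- `G` acts by conjugation on the set of the `x^M`, `A` acts trivially, and so `G/A` acts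
      (∃ ρ : YangBaxter.YBGroup r →* Equiv.Perm (YangBaxter.powerSet r M),
        (∀ g u, (ρ g u : YangBaxter.YBGroup r) = g * u * g⁻¹) ∧
        (∀ a ∈ YangBaxter.powerGroup r M, ∀ u, ρ a u = u) ∧
        ∃ ρ' : YangBaxter.YBGroup r ⧸ YangBaxter.powerGroup r M →*
            Equiv.Perm (YangBaxter.powerSet r M),
          ∀ g, ρ' (QuotientGroup.mk' (YangBaxter.powerGroup r M) g) = ρ g) ∧
      -- `A` lies in the kernel of the left action, which therefore factors through `G/A`
      YangBaxter.powerGroup r M ≤ (YangBaxter.leftHom h).ker ∧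
      (∃ L' : YangBaxter.YBGroup r ⧸ YangBaxter.powerGroup r M →* YangBaxter.leftGroup h,
        Function.Surjective L' ∧
        ∀ g, (L' (QuotientGroup.mk' (YangBaxter.powerGroup r M) g) : Equiv.Perm X) =
          YangBaxter.leftHom h g) ∧
      Nat.card (YangBaxter.leftGroup h) ∣ M ^ Fintype.card X := by
  classical
  subst hM
  have : NeZero (YangBaxter.cyclicDegree h) := ⟨(YangBaxter.cyclicDegree_pos h).ne'⟩
  have hN := YangBaxter.powerGroup_normal h
  obtain ⟨q⟩ := YangBaxter.powerGroup_quotient_equiv h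
  have hcard : Nat.card (YangBaxter.YBGroup r ⧸
      YangBaxter.powerGroup r (YangBaxter.cyclicDegree h)) =
      YangBaxter.cyclicDegree h ^ Fintype.card X := by
    rw [Nat.card_congr q, Nat.card_fun, Nat.card_zmod, Nat.card_eq_fintype_card]
  have hker : YangBaxter.powerGroup r (YangBaxter.cyclicDegree h) ≤
      (YangBaxter.leftHom h).rangeRestrict.ker := by
    rw [MonoidHom.ker_rangeRestrict]
    exact YangBaxter.powerGroup_le_ker h
  have hsurj : Function.Surjective (QuotientGroup.lift _ (YangBaxter.leftHom h).rangeRestrict hker) :=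
    QuotientGroup.lift_surjective_of_surjective _ _ (YangBaxter.leftHom h).rangeRestrict_surjective _
  refine ⟨YangBaxter.powerMonoid_free h,
    YangBaxter.wellFoundedGT_subMulAction (YangBaxter.exists_lt_eq_mul h),
    YangBaxter.wellFoundedGT_subMulAction fun f => ?_, YangBaxter.powerGroup_free h, hN,
    Finite.of_equiv _ q.symm, hcard, ⟨YangBaxter.powerSetConj h, fun _ _ => rfl, fun a ha u => ?_,
      QuotientGroup.lift _ (YangBaxter.powerSetConj h)
        fun a ha => YangBaxter.powerSetConj_eq_one h ha, fun _ => rfl⟩,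
    YangBaxter.powerGroup_le_ker h, ⟨_, hsurj, fun _ => rfl⟩, ?_⟩
  · obtain ⟨i, j, hij, t, ht⟩ := YangBaxter.exists_lt_eq_mul_right h f
    exact ⟨i, j, hij, MulOpposite.op t, ht⟩
  · rw [YangBaxter.powerSetConj_eq_one h ha]; rfl
  · rw [← hcard]
    exact Subgroup.card_dvd_of_surjective _ hsurj
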